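/- Work in many-sorted continuous first order logic. Fix a metric continuous signature $\mathcal L$ (each symbol comes with a uniform continuity modulus in each argument), a full system of continuous connectives (one that generates a uniformly dense set of the continuous functions $[0,1]^n\to[0,1]$ for every $n>0$, e.g. $\{\neg,\frac x2,\dot-\}$), a theory $T$ (not necessarily complete), and a formula $\varphi(x,y)$, where $x$ and $y$ are finite tuples of variables. Structures are complete metric structures with nonempty sorts of diameter at most $1$. **Definitions.** For $\varepsilon>0$, $\varphi$ is *$\varepsilon$-stable* if no model of $T$ contains an infinite sequence $(a_i,b_i)_{i<\omega}$ with $|\varphi(a_i,b_j)-\varphi(a_j,b_i)|\ge\varepsilon$ for all $i<j$; it is *stable* if it is $\varepsilon$-stable for every $\varepsilon>0$. Let $N(\varphi,\varepsilon)$ be the least $N$ such that no model of $T$ contains a sequence $(a_i,b_i)_{i<N+1}$ with $|\varphi(a_j,b_i)-\varphi(a_j,b_k)|\ge\varepsilon$ for all $i<j<k$. Put $$\mathrm{med}_n(t_0,\dots,t_{2n-2})=\min_{w\subseteq\{0,\dots,2n-2\},\,|w|=n}\ \max_{i\in w}t_i ,$$ $$d^\varepsilon\varphi(y,x_0,\dots,x_{2N-2})=\mathrm{med}_{N}\bigl(\varphi(x_i,y):i<2N-1\bigr),\qquad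 N=N(\varphi,\varepsilon).$$ The *forced limit* of a sequence $(a_n)$ in $[0,1]$ is $\mathrm{flim}_n\,a_n=\lim_n a'_n$, where $a'_0=a_0$ and $a'_{n+1}$ is the point of $[a'_n-2^{-n-1},\,a'_n+2^{-n-1}]$ closest to $a_{n+1}$. For stable $\varphi$, and $C=(c^n_i : n<\omega,\ i<2N(\varphi,2^{-n})-1)$, put $$d\varphi(y,C)=\mathrm{flim}_n\ d^{2^{-n}}\varphi\bigl(y,c^n_0,\dots,c^n_{2N(\varphi,2^{-n})-2}\bigr).$$ For a structure $M$, $S_x(M)$ is the space of complete types over $M$ in $x$ (the types over $M$ of tuples in elementary extensions of $M$), with the coarsest topology that makes $p\mapsto\psi(x,b)^p$ continuous for every formula $\psi(x,b)$ with parameters $b$ in $M$. The space $S_\varphi(M)$ of *$\varphi$-types* is the quotient of $S_x(M)$ that identifies types giving equal values to $\varphi(x,b)$ for all $b$ in $M$. An *$M$-definable predicate* $\psi(y)$ is a continuous function $S_y(M)\to[0,1]$, with $\psi^M(b)=\psi(\mathrm{tp}(b/M))$. With $\tilde\varphi(y,x)=\varphi(x,y)$, it is an *$M$-definable $\tilde\varphi$-predicate*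 if it factors through a continuous function $S_{\tilde\varphi}(M)\to[0,1]$. A *definition* of $p\in S_\varphi(M)$ is an $M$-definable predicate $\psi(y)$ with $\varphi(x,b)^p=\psi^M(b)$ for all $b$ in $M$. **Theorem.** 1. Let $\varepsilon>0$ and let $\varphi$ be $\varepsilon$-stable. Then $N(\varphi,\varepsilon)$ exists, and for every model $M$ of $T$ and every $p\in S_\varphi(M)$ there are $c_0,\dots,c_{2N(\varphi,\varepsilon)-2}$ in $M$ such that for every $b$ in $M$ $$\bigl|\varphi(x,b)^p-d^\varepsilon\varphi(b,c_0,\dots,c_{2N(\varphi,\varepsilon)-2})\bigr|\le\varepsilon .$$ 2. Let $\varphi$ be stable. Then for every model $M$ of $T$ and every $p\in S_\varphi(M)$ there is a family $C$ of parameters in $M$ such that $d\varphi(y,C)$ is a definition of $p$. It is the only definition of $p$, so that $d_p\varphi(y)=d\varphi(y,C)$. Moreover, $d_p\varphi$ is an $M$-definable $\tilde\varphi$-predicate. -/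

import Mathlib

open Filter Topology

universe u w

namespace ContLogic

/-! ### Connectives -/

/-- A system of continuous connectives: for every arity `n`, a collection of continuous functions
`[0,1]^n → [0,1]`. -/
abbrev ConnSystem : Type := ∀ n : ℕ, Set C(Fin n → unitInterval, unitInterval)

/-- The closed system of connectives generated by `F`: the least one containing `F` and the
projections, and closed under composition. -/
inductive ConnSystem.Closure (F : ConnSystem) :
    ∀ n : ℕ, C(Fin n → unitInterval, unitInterval) → Prop
  | basic {n : ℕ} (f : C(Fin n → unitInterval, unitInterval)) (hf : f ∈ F n) : Closure F n f
  | proj {n : ℕ} (i : Fin n) : Closure F n (ContinuousMap.eval i)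
  | comp {n m : ℕ} (f : C(Fin n → unitInterval, unitInterval))
      (g : Fin n → C(Fin m → unitInterval, unitInterval))
      (hf : Closure F n f) (hg : ∀ i, Closure F m (g i)) :
      Closure F m (f.comp (ContinuousMap.pi g))

/-- A system of connectives is full if, for every `n > 0`, the `n`-ary connectives that it generates
are uniformly dense among all continuous functions `[0,1]^n → [0,1]`. -/
def ConnSystem.Full (F : ConnSystem) : Prop :=
  ∀ n : ℕ, 0 < n → Dense {f : C(Fin n → unitInterval, unitInterval) | F.Closure n f}

/-! ### Signatures, terms and formulae -/

/-- A continuity modulus; only its values on `(0, ∞)` are used. -/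
structure Modulus where
  toFun : ℝ → ℝ
  pos : ∀ ε : ℝ, 0 < ε → 0 < toFun ε

/-- A many-sorted metric continuous signature. The distance symbol of each sort is a logical symbol
(see `Formula.dist`), and is not listed among the predicate symbols. -/
structure Signature where
  Sorts : Type u
  Func : Type u
  funcArity : Func → ℕ
  funcDom : ∀ f : Func, Fin (funcArity f) → Sorts
  funcCod : Func → Sorts
  funcMod : ∀ f : Func, Fin (funcArity f) → Modulus
  Pred : Type u
  predArity : Pred → ℕ
  predDom : ∀ P : Pred, Fin (predArity P) → Sorts
  predMod : ∀ P : Pred, Fin (predArity P) → Modulus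

/-- Terms, by target sort, in the variables `v : V` of sorts `σ v`. -/
inductive Term (L : Signature.{u}) {V : Type} (σ : V → L.Sorts) : L.Sorts → Type u
  | var (v : V) : Term L σ (σ v)
  | func (f : L.Func) (t : ∀ i, Term L σ (L.funcDom f i)) : Term L σ (L.funcCod f)

/-- The sorts of the variables after adding one new variable `none` of sort `s`. -/
def extSort {S : Type u} {V : Type} (σ : V → S) (s : S) : Option V → S
  | none => s
  | some v => σ v

/-- Continuous first order formulae, built with connectives from `F`, whose free variables are among
the variables `v : V` of sorts `σ v`. The quantifiers bind the variable `none`. -/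
inductive Formula (L : Signature.{u}) (F : ConnSystem) :
    ∀ {V : Type}, (V → L.Sorts) → Type (max u 1)
  | dist {V : Type} {σ : V → L.Sorts} (s : L.Sorts) (t₁ t₂ : Term L σ s) : Formula L F σ
  | pred {V : Type} {σ : V → L.Sorts} (P : L.Pred) (t : ∀ i, Term L σ (L.predDom P i)) :
      Formula L F σ
  | conn {V : Type} {σ : V → L.Sorts} {n : ℕ} (f : C(Fin n → unitInterval, unitInterval))
      (hf : f ∈ F n) (ψ : Fin n → Formula L F σ) : Formula L F σ
  | inf {V : Type} {σ : V → L.Sorts} (s : L.Sorts) (ψ : Formula L F (extSort σ s)) : Formula L F σ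
  | sup {V : Type} {σ : V → L.Sorts} (s : L.Sorts) (ψ : Formula L F (extSort σ s)) : Formula L F σ

variable {L : Signature.{u}} {F : ConnSystem}

/-- Substitution of terms for the variables of a term. -/
def Term.subst {V W : Type} {σ : V → L.Sorts} {τ : W → L.Sorts} (e : ∀ v, Term L τ (σ v)) :
    ∀ {s : L.Sorts}, Term L σ s → Term L τ s
  | _, .var v => e v
  | _, .func f t => .func f fun i => (t i).subst e

/-- A substitution, carried under a quantifier: the bound variable is left alone. -/
def extSubst {V W : Type} {σ : V → L.Sorts} {τ : W → L.Sorts} (e : ∀ v, Term L τ (σ v))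
    (s : L.Sorts) : ∀ v : Option V, Term L (extSort τ s) (extSort σ s v)
  | none => (Term.var none : Term L (extSort τ s) (extSort τ s none))
  | some v => (e v).subst fun x => (Term.var (some x) : Term L (extSort τ s) (extSort τ s (some x)))

/-- Substitution of terms for the free variables of a formula. -/
def Formula.subst {V : Type} {σ : V → L.Sorts} (ψ : Formula L F σ) :
    ∀ {W : Type} {τ : W → L.Sorts}, (∀ v, Term L τ (σ v)) → Formula L F τ :=
  match ψ with
  | .dist s t₁ t₂ => fun e => .dist s (t₁.subst e) (t₂.subst e)
  | .pred P t => fun e => .pred P fun i => (t i).subst e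
  | .conn f hf ψ => fun e => .conn f hf fun i => (ψ i).subst e
  | .inf s ψ => fun e => .inf s (ψ.subst (extSubst e s))
  | .sup s ψ => fun e => .sup s (ψ.subst (extSubst e s))

/-- For `φ(x, y)`, the same formula with the two groups of variables exchanged, `φ~(y, x)`. -/
def Formula.swap {m n : ℕ} {sx : Fin m → L.Sorts} {sy : Fin n → L.Sorts}
    (φ : Formula L F (Sum.elim sx sy)) : Formula L F (Sum.elim sy sx) :=
  φ.subst fun v => match v with
    | .inl i => (Term.var (Sum.inr i) : Term L (Sum.elim sy sx) (Sum.elim sy sx (Sum.inr i)))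
    | .inr j => (Term.var (Sum.inl j) : Term L (Sum.elim sy sx) (Sum.elim sy sx (Sum.inl j)))

/-! ### Structures -/

/-- A (metric) continuous structure: every sort is a nonempty complete metric space of diameter at
most `1`, and every symbol respects, in each argument, the modulus given by the signature. -/
structure MStructure (L : Signature.{u}) where
  carrier : L.Sorts → Type (max u w)
  metric : ∀ s, MetricSpace (carrier s)
  complete : ∀ s, CompleteSpace (carrier s)
  nonempty : ∀ s, Nonempty (carrier s)
  dist_le_one : ∀ s (a b : carrier s), dist a b ≤ 1
  func : ∀ f : L.Func, (∀ i, carrier (L.funcDom f i)) → carrier (L.funcCod f)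
  pred : ∀ P : L.Pred, (∀ i, carrier (L.predDom P i)) → unitInterval
  func_unif : ∀ (f : L.Func) (i : Fin (L.funcArity f)) (a : ∀ j, carrier (L.funcDom f j))
    (b c : carrier (L.funcDom f i)) (ε : ℝ), 0 < ε → dist b c < (L.funcMod f i).toFun ε →
    dist (func f (Function.update a i b)) (func f (Function.update a i c)) ≤ ε
  pred_unif : ∀ (P : L.Pred) (i : Fin (L.predArity P)) (a : ∀ j, carrier (L.predDom P j))
    (b c : carrier (L.predDom P i)) (ε : ℝ), 0 < ε → dist b c < (L.predMod P i).toFun ε →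
    |(pred P (Function.update a i b) : ℝ) - pred P (Function.update a i c)| ≤ ε

attribute [instance] MStructure.metric MStructure.complete MStructure.nonempty

/-- Tuples of elements of `M` of sorts `σ`; equivalently, assignments of values in `M` to variables
of sorts `σ`. -/
abbrev MStructure.Tuple (M : MStructure.{u, w} L) {V : Type} (σ : V → L.Sorts) : Type (max u w) :=
  ∀ v : V, M.carrier (σ v)

/-- The concatenation of two tuples. -/
def MStructure.pair (M : MStructure.{u, w} L) {V W : Type} {σ : V → L.Sorts} {τ : W → L.Sorts}
    (a : M.Tuple σ) (b : M.Tuple τ) : M.Tuple (Sum.elim σ τ)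
  | .inl v => a v
  | .inr v => b v

/-- The tuple `a` with the value `b` for the additional variable `none`. -/
def MStructure.cons (M : MStructure.{u, w} L) {V : Type} {σ : V → L.Sorts} {s : L.Sorts}
    (b : M.carrier s) (a : M.Tuple σ) : M.Tuple (extSort σ s)
  | none => b
  | some v => a v

/-- The interpretation of a term. -/
def Term.eval (M : MStructure.{u, w} L) {V : Type} {σ : V → L.Sorts} (a : M.Tuple σ) :
    ∀ {s : L.Sorts}, Term L σ s → M.carrier s
  | _, .var v => a v
  | _, .func f t => M.func f fun i => (t i).eval M a

/-- The interpretation of a formula, with values in `[0,1]`. -/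
noncomputable def Formula.eval (M : MStructure.{u, w} L) {V : Type} {σ : V → L.Sorts}
    (ψ : Formula L F σ) : M.Tuple σ → unitInterval :=
  match ψ with
  | .dist _ t₁ t₂ => fun a =>
      ⟨Dist.dist (t₁.eval M a) (t₂.eval M a), dist_nonneg, M.dist_le_one _ _ _⟩
  | .pred P t => fun a => M.pred P fun i => (t i).eval M a
  | .conn f _ ψ => fun a => f fun i => (ψ i).eval M a
  | .inf s ψ => fun a => ⨅ b : M.carrier s, ψ.eval M (M.cons b a)
  | .sup s ψ => fun a => ⨆ b : M.carrier s, ψ.eval M (M.cons b a)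

theorem Term.eval_subst (M : MStructure.{u, w} L) {V W : Type} {σ : V → L.Sorts}
    {τ : W → L.Sorts} (e : ∀ v, Term L τ (σ v)) (a : M.Tuple τ) {s : L.Sorts} (t : Term L σ s) :
    (t.subst e).eval M a = t.eval M fun v => (e v).eval M a := by
  induction t with
  | var v => rfl
  | func f t ih => simp only [Term.subst, Term.eval, ih]

theorem eval_extSubst (M : MStructure.{u, w} L) {V W : Type} {σ : V → L.Sorts}
    {τ : W → L.Sorts} (e : ∀ v, Term L τ (σ v)) (a : M.Tuple τ) {s : L.Sorts}
    (b : M.carrier s) :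
    (fun v => (extSubst e s v).eval M (M.cons b a)) = M.cons b fun v => (e v).eval M a := by
  funext v
  cases v with
  | none => rfl
  | some v =>
    simp only [extSubst]
    exact Term.eval_subst M _ _ (e v)

theorem Formula.eval_subst (M : MStructure.{u, w} L) {V : Type} {σ : V → L.Sorts}
    (ψ : Formula L F σ) {W : Type} {τ : W → L.Sorts} (e : ∀ v, Term L τ (σ v)) (a : M.Tuple τ) :
    (ψ.subst e).eval M a = ψ.eval M fun v => (e v).eval M a := by
  induction ψ generalizing W with
  | dist s t₁ t₂ => simp only [Formula.subst, Formula.eval, Term.eval_subst]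
  | pred P t => simp only [Formula.subst, Formula.eval, Term.eval_subst]
  | conn f hf ψ ih => simp only [Formula.subst, Formula.eval, ih]
  | inf s ψ ih => simp only [Formula.subst, Formula.eval, ih, eval_extSubst]
  | sup s ψ ih => simp only [Formula.subst, Formula.eval, ih, eval_extSubst]

theorem Formula.eval_swap (M : MStructure.{u, w} L) {m n : ℕ} {sx : Fin m → L.Sorts}
    {sy : Fin n → L.Sorts} (φ : Formula L F (Sum.elim sx sy)) (a : M.Tuple sx) (b : M.Tuple sy) :
    φ.swap.eval M (M.pair b a) = φ.eval M (M.pair a b) := by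
  rw [Formula.swap, Formula.eval_subst]
  congr 1
  funext v
  cases v <;> rfl

/-! ### Theories and elementary extensions -/

/-- A theory: a set of sentences `ψ`, standing for the conditions `ψ = 0`. -/
abbrev Theory (L : Signature.{u}) (F : ConnSystem) : Type (max u 1) :=
  Set (Formula L F (Empty.elim : Empty → L.Sorts))

/-- `M` is a model of `T`. -/
def MStructure.Models (M : MStructure.{u, w} L) (T : Theory L F) : Prop :=
  ∀ ψ ∈ T, ψ.eval M (fun v => v.elim) = 0

/-- An elementary embedding: a map that preserves the values of all formulae. (It preserves the
interpretations of all symbols, as these are expressed by atomic formulae.) -/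
structure ElemEmbedding (F : ConnSystem) (M N : MStructure.{u, w} L) where
  toFun : ∀ s, M.carrier s → N.carrier s
  map_eval : ∀ {V : Type} {σ : V → L.Sorts} (ψ : Formula L F σ) (a : M.Tuple σ),
    ψ.eval N (fun v => toFun _ (a v)) = ψ.eval M a

/-- The identity as an elementary embedding. -/
def ElemEmbedding.refl (F : ConnSystem) (M : MStructure.{u, w} L) : ElemEmbedding F M M where
  toFun _ a := a
  map_eval _ _ := rfl

/-! ### Complete types over a structure, and local types -/

/-- A formula `ψ(x, b)` in the tuple of variables `x`, of sorts `sx`, with parameters `b` in `M`. -/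
structure ParamFormula (F : ConnSystem) (M : MStructure.{u, w} L) {m : ℕ}
    (sx : Fin m → L.Sorts) where
  {k : ℕ}
  {sorts : Fin k → L.Sorts}
  formula : Formula L F (Sum.elim sx sorts)
  params : M.Tuple sorts

/-- The space of complete types over `M` in the tuple of variables `x` of sorts `sx`. A complete
type is identified with the map `ψ(x, b) ↦ ψ(x, b)^p`; these maps are exactly those given by the
tuples of elementary extensions of `M`. -/
def TypeSpace (F : ConnSystem) (M : MStructure.{u, w} L) {m : ℕ} (sx : Fin m → L.Sorts) :
    Type (max u w 1) :=
  {p : ParamFormula F M sx → unitInterval //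
    ∃ (N : MStructure.{u, w} L) (h : ElemEmbedding F M N) (a : N.Tuple sx),
      ∀ ψ : ParamFormula F M sx,
        p ψ = ψ.formula.eval N (N.pair a fun i => h.toFun _ (ψ.params i))}

/-- The logic topology: the coarsest one for which all `p ↦ ψ(x, b)^p` are continuous. -/
instance {M : MStructure.{u, w} L} {m : ℕ} {sx : Fin m → L.Sorts} :
    TopologicalSpace (TypeSpace F M sx) :=
  inferInstanceAs (TopologicalSpace
    {p : ParamFormula F M sx → unitInterval //
      ∃ (N : MStructure.{u, w} L) (h : ElemEmbedding F M N) (a : N.Tuple sx),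
        ∀ ψ : ParamFormula F M sx,
          p ψ = ψ.formula.eval N (N.pair a fun i => h.toFun _ (ψ.params i))})

/-- `ψ(x, b)^p`, the value of a formula with parameters according to a complete type. -/
def TypeSpace.val {M : MStructure.{u, w} L} {m : ℕ} {sx : Fin m → L.Sorts}
    (p : TypeSpace F M sx) (ψ : ParamFormula F M sx) : unitInterval :=
  p.1 ψ

/-- The type over `M` of a tuple of `M`. -/
noncomputable def tp (F : ConnSystem) (M : MStructure.{u, w} L) {m : ℕ} {sx : Fin m → L.Sorts}
    (a : M.Tuple sx) : TypeSpace F M sx :=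
  ⟨fun ψ => ψ.formula.eval M (M.pair a ψ.params), M, ElemEmbedding.refl F M, a, fun _ => rfl⟩

section Local

variable {m n : ℕ} {sx : Fin m → L.Sorts} {sy : Fin n → L.Sorts}

/-- Two complete types over `M` are identified if they give the same value to `φ(x, b)` for all `b`
in `M`. -/
def phiSetoid (M : MStructure.{u, w} L) (φ : Formula L F (Sum.elim sx sy)) :
    Setoid (TypeSpace F M sx) where
  r p q := ∀ b : M.Tuple sy, p.val ⟨φ, b⟩ = q.val ⟨φ, b⟩
  iseqv := ⟨fun _ _ => rfl, fun h b => (h b).symm, fun h h' b => (h b).trans (h' b)⟩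

/-- The space of complete `φ`-types over `M`, the quotient of the space of complete types over `M`
determined by the functions `φ(x, b)` with `b` in `M`. -/
def PhiType (M : MStructure.{u, w} L) (φ : Formula L F (Sum.elim sx sy)) : Type (max u w 1) :=
  Quotient (phiSetoid M φ)

/-- The quotient topology. -/
instance {M : MStructure.{u, w} L} {φ : Formula L F (Sum.elim sx sy)} :
    TopologicalSpace (PhiType M φ) :=
  inferInstanceAs (TopologicalSpace (Quotient (phiSetoid M φ)))

/-- The restriction of a complete type to a `φ`-type. -/
def PhiType.mk {M : MStructure.{u, w} L} (φ : Formula L F (Sum.elim sx sy))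
    (p : TypeSpace F M sx) : PhiType M φ :=
  Quotient.mk (phiSetoid M φ) p

/-- `φ(x, b)^p` for a `φ`-type `p`. -/
def PhiType.val {M : MStructure.{u, w} L} {φ : Formula L F (Sum.elim sx sy)} (p : PhiType M φ)
    (b : M.Tuple sy) : unitInterval :=
  Quotient.lift (s := phiSetoid M φ) (fun q : TypeSpace F M sx => q.val ⟨φ, b⟩)
    (fun _ _ h => h b) p

/-- `M`-definable predicates `ψ(x)`, as functions on the space of complete types over `M`. -/
def IsDefinablePred {M : MStructure.{u, w} L} (ψ : TypeSpace F M sx → unitInterval) : Prop :=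
  Continuous ψ

/-- `M`-definable `φ`-predicates: continuous functions on the space of `φ`-types, viewed as functions
on the space of complete types. -/
def IsPhiPred {M : MStructure.{u, w} L} (φ : Formula L F (Sum.elim sx sy))
    (ψ : TypeSpace F M sx → unitInterval) : Prop :=
  ∃ χ : PhiType M φ → unitInterval, Continuous χ ∧ ∀ p, ψ p = χ (PhiType.mk φ p)

/-- `ψ(y)` is a definition of the `φ`-type `p`: it is an `M`-definable predicate, and
`φ(x, b)^p = ψ^M(b)` for all `b` in `M`. -/
def IsDefinition {M : MStructure.{u, w} L} {φ : Formula L F (Sum.elim sx sy)} (p : PhiType M φ)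
    (ψ : TypeSpace F M sy → unitInterval) : Prop :=
  IsDefinablePred ψ ∧ ∀ b : M.Tuple sy, p.val b = ψ (tp F M b)

/-! ### Stability -/

/-- `φ(x, y)` is `ε`-stable with respect to `T`: no model of `T` has an infinite sequence
`(a_i, b_i)` with `|φ(a_i, b_j) - φ(a_j, b_i)| ≥ ε` for all `i < j`. -/
def EpsStable.{u₁, w₁} {L : Signature.{u₁}} {F : ConnSystem} {m n : ℕ} {sx : Fin m → L.Sorts}
    {sy : Fin n → L.Sorts} (T : Theory L F) (φ : Formula L F (Sum.elim sx sy)) (ε : ℝ) : Prop :=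
  ∀ M : MStructure.{u₁, w₁} L, M.Models T →
    ¬ ∃ (a : ℕ → M.Tuple sx) (b : ℕ → M.Tuple sy), ∀ i j, i < j →
      ε ≤ |(φ.eval M (M.pair (a i) (b j)) : ℝ) - φ.eval M (M.pair (a j) (b i))|

/-- `φ(x, y)` is stable with respect to `T`. -/
def Stable.{u₁, w₁} {L : Signature.{u₁}} {F : ConnSystem} {m n : ℕ} {sx : Fin m → L.Sorts}
    {sy : Fin n → L.Sorts} (T : Theory L F) (φ : Formula L F (Sum.elim sx sy)) : Prop :=
  ∀ ε : ℝ, 0 < ε → EpsStable.{u₁, w₁} T φ ε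

/-- No model of `T` has a sequence `(a_i, b_i)`, `i < N`, such that
`|φ(a_j, b_i) - φ(a_j, b_k)| ≥ ε` for all `i < j < k`. -/
def NoAlternation.{u₁, w₁} {L : Signature.{u₁}} {F : ConnSystem} {m n : ℕ}
    {sx : Fin m → L.Sorts} {sy : Fin n → L.Sorts} (T : Theory L F)
    (φ : Formula L F (Sum.elim sx sy)) (ε : ℝ) (N : ℕ) : Prop :=
  ∀ M : MStructure.{u₁, w₁} L, M.Models T →
    ¬ ∃ (a : Fin N → M.Tuple sx) (b : Fin N → M.Tuple sy), ∀ i j k, i < j → j < k →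
      ε ≤ |(φ.eval M (M.pair (a j) (b i)) : ℝ) - φ.eval M (M.pair (a j) (b k))|

/-- `N(φ, ε)`: the least `N` for which there is no alternating sequence of length `N + 1`. -/
noncomputable def stabN.{u₁, w₁} {L : Signature.{u₁}} {F : ConnSystem} {m n : ℕ}
    {sx : Fin m → L.Sorts} {sy : Fin n → L.Sorts} (T : Theory L F)
    (φ : Formula L F (Sum.elim sx sy)) (ε : ℝ) : ℕ :=
  sInf {N : ℕ | NoAlternation.{u₁, w₁} T φ ε (N + 1)}

end Local

/-! ### Median values and forced limits -/

/-- The median value connective `med_n : [0,1]^(2n-1) → [0,1]`, the minimum over all `n`-element sets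
`w` of indices of `max {t i | i ∈ w}`. -/
noncomputable def med (n : ℕ) (t : Fin (2 * n - 1) → unitInterval) : unitInterval :=
  (Finset.univ.powersetCard n).inf fun w : Finset (Fin (2 * n - 1)) => w.sup t

/-- The modified sequence used to define forced limits. -/
noncomputable def flimSeq (a : ℕ → unitInterval) : ℕ → ℝ
  | 0 => a 0
  | k + 1 =>
    if flimSeq a k + 2⁻¹ ^ (k + 1) ≤ a (k + 1) then flimSeq a k + 2⁻¹ ^ (k + 1)
    else if (a (k + 1) : ℝ) ≤ flimSeq a k - 2⁻¹ ^ (k + 1) then flimSeq a k - 2⁻¹ ^ (k + 1)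
    else a (k + 1)

theorem flimSeq_mem (a : ℕ → unitInterval) (k : ℕ) : flimSeq a k ∈ Set.Icc (0 : ℝ) 1 := by
  induction k with
  | zero => exact (a 0).2
  | succ k ih =>
    have h := (a (k + 1)).2
    have hp : (0 : ℝ) < 2⁻¹ ^ (k + 1) := by positivity
    simp only [Set.mem_Icc] at ih h ⊢
    rw [flimSeq]
    split_ifs
    · constructor <;> linarith
    · constructor <;> linarith
    · exact h

theorem dist_flimSeq_le (a : ℕ → unitInterval) (k : ℕ) :
    dist (flimSeq a k) (flimSeq a (k + 1)) ≤ 1 / 2 / 2 ^ k := by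
  have e : (1 : ℝ) / 2 / 2 ^ k = 2⁻¹ ^ (k + 1) := by
    rw [pow_succ, inv_pow]; field_simp
  have hp : (0 : ℝ) < 2⁻¹ ^ (k + 1) := by positivity
  rw [e, Real.dist_eq, abs_le, flimSeq]
  split_ifs <;> constructor <;> linarith

theorem exists_tendsto_flimSeq (a : ℕ → unitInterval) :
    ∃ l : unitInterval, Tendsto (flimSeq a) atTop (𝓝 (l : ℝ)) := by
  obtain ⟨l, hl⟩ := cauchySeq_tendsto_of_complete
    (cauchySeq_of_le_geometric_two (dist_flimSeq_le a))
  exact ⟨⟨l, isClosed_Icc.mem_of_tendsto hl (Eventually.of_forall (flimSeq_mem a))⟩, hl⟩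

/-- The forced limit of a sequence in `[0,1]`. -/
noncomputable def flim (a : ℕ → unitInterval) : unitInterval :=
  (exists_tendsto_flimSeq a).choose

theorem tendsto_flim (a : ℕ → unitInterval) :
    Tendsto (flimSeq a) atTop (𝓝 (flim a : ℝ)) :=
  (exists_tendsto_flimSeq a).choose_spec

section Predicates

variable {m n : ℕ} {sx : Fin m → L.Sorts} {sy : Fin n → L.Sorts} {M : MStructure.{u, w} L}

/-- `med_N (φ(c_i, y) : i < 2N - 1)`, where the `c_i` are in `M`, as a function on the space of
complete types over `M` in the variables `y`. -/
noncomputable def medPhi (φ : Formula L F (Sum.elim sx sy)) (N : ℕ)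
    (c : Fin (2 * N - 1) → M.Tuple sx) (q : TypeSpace F M sy) : unitInterval :=
  med N fun i => q.val ⟨φ.swap, c i⟩

/-- `d^ε φ(y, c) = med_N (φ(c_i, y) : i < 2N - 1)` with `N = N(φ, ε)`. -/
noncomputable def dEps (T : Theory L F) (φ : Formula L F (Sum.elim sx sy)) (ε : ℝ)
    (c : Fin (2 * stabN.{u, w} T φ ε - 1) → M.Tuple sx) (q : TypeSpace F M sy) : unitInterval :=
  medPhi φ (stabN.{u, w} T φ ε) c q

/-- `dφ(y, C)`, the forced limit of the `d^ε φ(y, c^k)` with `ε = 2^(-k)`, where `C` consists of the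
`c^k_i`, `i < 2 N(φ, 2^(-k)) - 1`. -/
noncomputable def dPhi (T : Theory L F) (φ : Formula L F (Sum.elim sx sy))
    (C : ∀ k : ℕ, Fin (2 * stabN.{u, w} T φ (2⁻¹ ^ k) - 1) → M.Tuple sx)
    (q : TypeSpace F M sy) : unitInterval :=
  flim fun k => dEps T φ (2⁻¹ ^ k) (C k) q

end Predicates

end ContLogic

open ContLogic

/-! Compactness is supplied by metric ultraproducts over `ℕ` and Łoś's theorem. It has two uses.
Were there alternating sequences of every finite length, there would be an infinite one; its two
iterated limits differ by at least `ε`, and another ultraproduct realizes those limits exactly,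
contradicting `ε`-stability (`EpsStable.exists_noAlternation`). And since the alternation conditions
are closed, excluding them for `ε` excludes them for some `ε - η` (`NoAlternation.exists_sub`).

A `φ`-type `p` over `M` is realized in an elementary extension. Fullness of the connectives lets one
formula express closeness to finitely many prescribed values, so `b ↦ φ(x, b)^p` is approximated on
any finite set by some `φ(a, ·)` with `a` in `M`.

The core is combinatorial (`exists_med_near`). Points `c_0, c_1, ...` are chosen greedily, each
approximating `p` at finitely many test points determined by the earlier ones. If a median of `2N -
1` values is off by more than `ε` at `b`, then `N` of the values are off on the same side. Test
points nearly extremal for `p` among those where initial segments of these `N` points deviate turn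
this into an alternating sequence of length `N + 1` in `M`, with the slack `η` absorbing the errors.

Forced limits are uniform limits of continuous functions and recover the limit when the errors are
at most `2^(-k)`, which yields the definition. It is unique because types of tuples of `M` are dense
in the type space. -/

namespace ContLogic

/-! ### Ultralimits in the unit interval -/

/-- The limit of a sequence in `[0,1]` along a fixed nonprincipal ultrafilter on `ℕ`. -/
noncomputable def ulim (x : ℕ → unitInterval) : unitInterval :=
  ((hyperfilter ℕ).map x).lim

theorem tendsto_ulim (x : ℕ → unitInterval) :
    Tendsto x (hyperfilter ℕ : Filter ℕ) (𝓝 (ulim x)) :=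
  Ultrafilter.le_nhds_lim ((hyperfilter ℕ).map x)

theorem tendsto_ulim_coe (x : ℕ → unitInterval) :
    Tendsto (fun k => (x k : ℝ)) (hyperfilter ℕ : Filter ℕ) (𝓝 (ulim x : ℝ)) :=
  (continuous_subtype_val.tendsto _).comp (tendsto_ulim x)

/-! ### Joint uniform continuity of the symbols -/

/-- The coordinates in `s` are changed one at a time, each new one taking half of the remaining
error. Choosing `δ` before the spaces and the map makes it uniform over all structures, as the
ultraproduct requires. -/
theorem exists_delta_of_moduli {n : ℕ} (μ : Fin n → Modulus) (s : Finset (Fin n)) :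
    ∀ ε : ℝ, 0 < ε → ∃ δ : ℝ, 0 < δ ∧ ∀ (X : Fin n → Type u) [∀ i, MetricSpace (X i)]
      (Y : Type w) [PseudoMetricSpace Y] (f : (∀ i, X i) → Y),
      (∀ (i : Fin n) (a : ∀ j, X j) (b c : X i) (ε : ℝ), 0 < ε → dist b c < (μ i).toFun ε →
        dist (f (Function.update a i b)) (f (Function.update a i c)) ≤ ε) →
      ∀ a b : ∀ i, X i, (∀ i ∉ s, a i = b i) → (∀ i, dist (a i) (b i) < δ) →
        dist (f a) (f b) ≤ ε := by
  classical
  induction s using Finset.induction_on with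
  | empty =>
    intro ε hε
    refine ⟨1, one_pos, fun X _ Y _ f _ a b hab _ => ?_⟩
    have : a = b := funext fun i => hab i (by simp)
    rw [this, dist_self]
    exact hε.le
  | insert i s hi ih =>
    intro ε hε
    obtain ⟨δ, hδ, H⟩ := ih (ε / 2) (half_pos hε)
    refine ⟨min δ ((μ i).toFun (ε / 2)), lt_min hδ ((μ i).pos _ (half_pos hε)),
      fun X _ Y _ f hf a b hab hd => ?_⟩
    have h₁ : dist (f a) (f (Function.update a i (b i))) ≤ ε / 2 := by
      have := hf i a (a i) (b i) (ε / 2) (half_pos hε) ((hd i).trans_le (min_le_right _ _))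
      rwa [Function.update_eq_self] at this
    have h₂ : dist (f (Function.update a i (b i))) (f b) ≤ ε / 2 := by
      refine H X Y f hf _ b (fun j hj => ?_) (fun j => ?_)
      · by_cases hji : j = i
        · subst hji; simp
        · rw [Function.update_of_ne hji]
          exact hab j (by simp [hji, hj])
      · by_cases hji : j = i
        · subst hji; simpa using hδ
        · rw [Function.update_of_ne hji]
          exact (hd j).trans_le (min_le_left _ _)
    linarith [dist_triangle (f a) (f (Function.update a i (b i))) (f b)]

/-! ### Ultraproducts -/

variable {L : Signature.{u}} {F : ConnSystem}

/-- The sort `s` of the ultraproduct of the `M k`, before identifying points at distance zero. -/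
def PreUltraproduct (M : ℕ → MStructure.{u, w} L) (s : L.Sorts) : Type (max u w) :=
  ∀ k, (M k).carrier s

namespace PreUltraproduct

variable {M : ℕ → MStructure.{u, w} L} {s : L.Sorts}

/-- The sequence of distances between two sequences of elements. -/
def distSeq (x y : PreUltraproduct M s) (k : ℕ) : unitInterval :=
  ⟨dist (x k) (y k), dist_nonneg, (M k).dist_le_one _ _ _⟩

noncomputable instance : PseudoMetricSpace (PreUltraproduct M s) where
  dist x y := ulim (distSeq x y)
  dist_self x := by
    refine tendsto_nhds_unique (tendsto_ulim_coe _) ?_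
    simp [distSeq]
  dist_comm x y := by
    congr 2
    funext k
    exact Subtype.ext (dist_comm _ _)
  dist_triangle x y z :=
    le_of_tendsto_of_tendsto' (tendsto_ulim_coe _)
      ((tendsto_ulim_coe _).add (tendsto_ulim_coe _)) fun _ => dist_triangle _ _ _

theorem tendsto_dist (x y : PreUltraproduct M s) :
    Tendsto (fun k => dist (x k) (y k)) (hyperfilter ℕ : Filter ℕ) (𝓝 (dist x y)) :=
  tendsto_ulim_coe (distSeq x y)

/-- A diagonal sequence is already a limit, so no completion is needed: at index `k` it follows `v
n` for the largest `n ≤ k` such that the Cauchy bounds up to `n` hold at `k`. Each `n` is reached on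
a large set of indices. -/
instance : CompleteSpace (PreUltraproduct M s) := by
  classical
  refine Metric.complete_of_convergent_controlled_sequences (fun n => 2⁻¹ ^ n)
    (fun n => by positivity) fun v hv => ?_
  let P : ℕ → ℕ → Prop := fun k n => ∀ i ≤ n, dist (v i k) (v n k) < 2⁻¹ ^ i
  let y : PreUltraproduct M s := fun k => v (Nat.findGreatest (P k) k) k
  have hP : ∀ n, ∀ᶠ k in (hyperfilter ℕ : Filter ℕ), P k n := fun n => by
    have := (Set.finite_Iic n).eventually_all (l := (hyperfilter ℕ : Filter ℕ))
      (p := fun i k => dist (v i k) (v n k) < 2⁻¹ ^ i)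
    exact this.2 fun i hi => (tendsto_dist (v i) (v n)).eventually_lt_const (hv i i n le_rfl hi)
  have hd : ∀ n, dist (v n) y ≤ 2⁻¹ ^ n := fun n => by
    refine le_of_tendsto (tendsto_dist (v n) y) ?_
    filter_upwards [hP n, Nat.hyperfilter_le_atTop (eventually_ge_atTop n)] with k hk hnk
    exact (Nat.findGreatest_spec hnk hk n (Nat.le_findGreatest hnk hk)).le
  refine ⟨y, tendsto_iff_dist_tendsto_zero.2 ?_⟩
  exact squeeze_zero (fun _ => dist_nonneg) hd
    (tendsto_pow_atTop_nhds_zero_of_lt_one (by norm_num) (by norm_num))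

/-- The class of a sequence in the ultraproduct. -/
noncomputable abbrev ofSeq (x : ∀ k, (M k).carrier s) : SeparationQuotient (PreUltraproduct M s) :=
  SeparationQuotient.mk (X := PreUltraproduct M s) x

theorem ofSeq_eq_ofSeq {x y : ∀ k, (M k).carrier s} :
    ofSeq x = ofSeq y ↔ Tendsto (fun k => dist (x k) (y k)) (hyperfilter ℕ : Filter ℕ) (𝓝 0) := by
  refine SeparationQuotient.mk_eq_mk.trans (Metric.inseparable_iff.trans ?_)
  exact ⟨fun h => h ▸ tendsto_dist (M := M) x y, tendsto_nhds_unique (tendsto_dist (M := M) x y)⟩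

theorem tendsto_dist_ofSeq (x y : ∀ k, (M k).carrier s) :
    Tendsto (fun k => dist (x k) (y k)) (hyperfilter ℕ : Filter ℕ) (𝓝 (dist (ofSeq x) (ofSeq y))) :=
  tendsto_dist (M := M) x y

theorem ofSeq_surjective (x : SeparationQuotient (PreUltraproduct M s)) :
    ∃ y : ∀ k, (M k).carrier s, ofSeq y = x :=
  SeparationQuotient.surjective_mk x

/-- A representative of an element of the ultraproduct. -/
noncomputable def out (x : SeparationQuotient (PreUltraproduct M s)) : ∀ k, (M k).carrier s :=
  (ofSeq_surjective x).choose

@[simp]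
theorem ofSeq_out (x : SeparationQuotient (PreUltraproduct M s)) : ofSeq (out x) = x :=
  (ofSeq_surjective x).choose_spec

theorem update_ofSeq {n : ℕ} {d : Fin n → L.Sorts} (a : ∀ i, ∀ k, (M k).carrier (d i)) (i : Fin n)
    (b : ∀ k, (M k).carrier (d i)) :
    Function.update (fun j => ofSeq (a j)) i (ofSeq b) = fun j => ofSeq (Function.update a i b j) :=
  funext fun j => (Function.apply_update (fun _ => ofSeq) a i b j).symm

theorem update_apply {n : ℕ} {d : Fin n → L.Sorts} (a : ∀ i, ∀ k, (M k).carrier (d i))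
    (i : Fin n) (b : ∀ k, (M k).carrier (d i)) (k : ℕ) :
    (fun j => Function.update a i b j k) = Function.update (fun j => a j k) i (b k) :=
  funext fun j => Function.apply_update (fun _ x => x k) a i b j

/-- Uniformly continuous maps send equivalent tuples of sequences to equivalent sequences. -/
theorem tendsto_dist_of_moduli {n : ℕ} {d : Fin n → L.Sorts} (μ : Fin n → Modulus)
    (Y : ℕ → Type*) [∀ k, PseudoMetricSpace (Y k)]
    (f : ∀ k, (∀ i, (M k).carrier (d i)) → Y k)
    (hf : ∀ k, ∀ (i : Fin n) (a : ∀ j, (M k).carrier (d j)) (b c : (M k).carrier (d i)) (ε : ℝ),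
      0 < ε → dist b c < (μ i).toFun ε →
        dist (f k (Function.update a i b)) (f k (Function.update a i c)) ≤ ε)
    (a b : ∀ i, ∀ k, (M k).carrier (d i)) (hab : ∀ i, ofSeq (a i) = ofSeq (b i)) :
    Tendsto (fun k => dist (f k fun i => a i k) (f k fun i => b i k))
      (hyperfilter ℕ : Filter ℕ) (𝓝 0) := by
  rw [Metric.tendsto_nhds]
  intro ε hε
  obtain ⟨δ, hδ, H⟩ := exists_delta_of_moduli μ Finset.univ (ε / 2) (half_pos hε)
  have h : ∀ᶠ k in (hyperfilter ℕ : Filter ℕ), ∀ i, dist (a i k) (b i k) < δ :=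
    eventually_all.2 fun i => (ofSeq_eq_ofSeq.1 (hab i)).eventually_lt_const hδ
  filter_upwards [h] with k hk
  rw [Real.dist_0_eq_abs, abs_of_nonneg dist_nonneg]
  exact (H _ (Y k) (f k) (hf k) _ _ (by simp) hk).trans_lt (half_lt_self hε)

end PreUltraproduct

/-! ### The ultraproduct as a metric structure, and Łoś's theorem. -/

namespace MStructure

open PreUltraproduct

variable (M : ℕ → MStructure.{u, w} L)

/-- The interpretation of a function symbol in the ultraproduct. -/
noncomputable def ultraFunc (f : L.Func)
    (x : ∀ i, SeparationQuotient (PreUltraproduct M (L.funcDom f i))) :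
    SeparationQuotient (PreUltraproduct M (L.funcCod f)) :=
  ofSeq fun k => (M k).func f fun i => out (x i) k

/-- The interpretation of a predicate symbol in the ultraproduct. -/
noncomputable def ultraPred (P : L.Pred)
    (x : ∀ i, SeparationQuotient (PreUltraproduct M (L.predDom P i))) : unitInterval :=
  ulim fun k => (M k).pred P fun i => out (x i) k

theorem ultraFunc_ofSeq (f : L.Func) (x : ∀ i, ∀ k, (M k).carrier (L.funcDom f i)) :
    ultraFunc M f (fun i => ofSeq (x i)) = ofSeq fun k => (M k).func f fun i => x i k :=
  ofSeq_eq_ofSeq.2 <| tendsto_dist_of_moduli (L.funcMod f) (fun k => (M k).carrier (L.funcCod f))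
    (fun k => (M k).func f) (fun k => (M k).func_unif f) _ _ fun i => ofSeq_out (ofSeq (x i))

theorem tendsto_ultraPred_ofSeq (P : L.Pred) (x : ∀ i, ∀ k, (M k).carrier (L.predDom P i)) :
    Tendsto (fun k => (M k).pred P fun i => x i k) (hyperfilter ℕ : Filter ℕ)
      (𝓝 (ultraPred M P fun i => ofSeq (x i))) := by
  refine tendsto_of_tendsto_of_dist (tendsto_ulim _) ?_
  exact tendsto_dist_of_moduli (L.predMod P) (fun _ => unitInterval)
    (fun k => (M k).pred P) (fun k => (M k).pred_unif P) _ _ fun i => ofSeq_out (ofSeq (x i))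

/-- The ultraproduct of a sequence of structures along a nonprincipal ultrafilter on `ℕ`. -/
noncomputable def ultraproduct : MStructure.{u, w} L where
  carrier s := SeparationQuotient (PreUltraproduct M s)
  metric _ := inferInstance
  complete _ := inferInstance
  nonempty s := ⟨ofSeq fun k => Classical.choice ((M k).nonempty s)⟩
  dist_le_one s a b := by
    rw [← ofSeq_out a, ← ofSeq_out b]
    exact le_of_tendsto' (tendsto_dist_ofSeq _ _) fun k => (M k).dist_le_one _ _ _
  func := ultraFunc M
  pred := ultraPred M
  func_unif f i a b c ε hε hbc := by
    have ha : a = fun j => ofSeq (out (a j)) := funext fun j => (ofSeq_out _).symm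
    rw [← ofSeq_out b, ← ofSeq_out c] at hbc ⊢
    rw [ha]
    rw [update_ofSeq, update_ofSeq, ultraFunc_ofSeq, ultraFunc_ofSeq]
    refine le_of_tendsto (tendsto_dist_ofSeq _ _) ?_
    filter_upwards [(tendsto_dist_ofSeq _ _).eventually_lt_const hbc] with k hk
    rw [update_apply, update_apply]
    exact (M k).func_unif f i _ _ _ ε hε hk
  pred_unif P i a b c ε hε hbc := by
    have ha : a = fun j => ofSeq (out (a j)) := funext fun j => (ofSeq_out _).symm
    rw [← ofSeq_out b, ← ofSeq_out c] at hbc ⊢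
    rw [ha]
    rw [update_ofSeq, update_ofSeq]
    refine le_of_tendsto ((((continuous_subtype_val.tendsto _).comp
      (tendsto_ultraPred_ofSeq M P _)).sub ((continuous_subtype_val.tendsto _).comp
      (tendsto_ultraPred_ofSeq M P _))).abs) ?_
    filter_upwards [(tendsto_dist_ofSeq _ _).eventually_lt_const hbc] with k hk
    simp only [Function.comp_apply]
    rw [update_apply, update_apply]
    exact (M k).pred_unif P i _ _ _ ε hε hk

/-- The tuple of the ultraproduct represented by a sequence of tuples. -/
noncomputable def ultraTuple {V : Type} {σ : V → L.Sorts} (a : ∀ k, (M k).Tuple σ) :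
    (ultraproduct M).Tuple σ :=
  fun v => ofSeq fun k => a k v

theorem ultraTuple_pair {V W : Type} {σ : V → L.Sorts} {τ : W → L.Sorts}
    (a : ∀ k, (M k).Tuple σ) (b : ∀ k, (M k).Tuple τ) :
    (ultraTuple M fun k => (M k).pair (a k) (b k)) =
      (ultraproduct M).pair (ultraTuple M a) (ultraTuple M b) := by
  funext v
  cases v <;> rfl

theorem ultraTuple_cons {V : Type} {σ : V → L.Sorts} {s : L.Sorts}
    (b : ∀ k, (M k).carrier s) (a : ∀ k, (M k).Tuple σ) :
    (ultraTuple M fun k => (M k).cons (b k) (a k)) =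
      (ultraproduct M).cons (ofSeq b) (ultraTuple M a) := by
  funext v
  cases v <;> rfl

theorem eval_ultraTuple {V : Type} {σ : V → L.Sorts} (a : ∀ k, (M k).Tuple σ) {s : L.Sorts}
    (t : Term L σ s) :
    t.eval (ultraproduct M) (ultraTuple M a) = ofSeq fun k => t.eval (M k) (a k) := by
  induction t with
  | var v => rfl
  | func f t ih =>
    simp only [Term.eval, ih]
    exact ultraFunc_ofSeq M f _

/-- Łoś's theorem. -/
theorem tendsto_eval_ultraTuple {V : Type} {σ : V → L.Sorts} (ψ : Formula L F σ)
    (a : ∀ k, (M k).Tuple σ) :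
    Tendsto (fun k => ψ.eval (M k) (a k)) (hyperfilter ℕ : Filter ℕ)
      (𝓝 (ψ.eval (ultraproduct M) (ultraTuple M a))) := by
  induction ψ with
  | dist s t₁ t₂ =>
    simp only [Formula.eval, eval_ultraTuple]
    exact tendsto_subtype_rng.2 (tendsto_dist_ofSeq _ _)
  | pred P t =>
    simp only [Formula.eval, eval_ultraTuple]
    exact tendsto_ultraPred_ofSeq M P _
  | conn f hf ψ ih =>
    simp only [Formula.eval]
    exact (f.continuous.tendsto _).comp (tendsto_pi_nhds.2 fun i => ih i a)
  | inf s ψ ih =>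
    simp only [Formula.eval]
    refine tendsto_order.2 ⟨fun c hc => ?_, fun c hc => ?_⟩
    · obtain ⟨c', hcc', hc'⟩ := exists_between hc
      by_contra hn
      rw [← Ultrafilter.eventually_not] at hn
      -- Near-minimizers where the infimum is below `c'`, arbitrary points elsewhere. Their class
      -- would give the infimum in the ultraproduct a value at most `c'`.
      have : ∀ k, ∃ b : (M k).carrier s, (⨅ b, ψ.eval (M k) ((M k).cons b (a k))) < c' →
          ψ.eval (M k) ((M k).cons b (a k)) < c' := fun k => by
        by_cases h : (⨅ b, ψ.eval (M k) ((M k).cons b (a k))) < c'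
        · obtain ⟨b, hb⟩ := iInf_lt_iff.1 h
          exact ⟨b, fun _ => hb⟩
        · exact ⟨Classical.choice ((M k).nonempty s), fun h' => absurd h' h⟩
      choose b hb using this
      have h := ih fun k => (M k).cons (b k) (a k)
      rw [ultraTuple_cons] at h
      refine absurd (hc'.trans_le (iInf_le _ (ofSeq b))) (not_lt.2 (le_of_tendsto h ?_))
      filter_upwards [hn] with k hk
      exact (hb k ((not_lt.1 hk).trans_lt hcc')).le
    · obtain ⟨b, hb⟩ := iInf_lt_iff.1 hc
      obtain ⟨x, rfl⟩ := ofSeq_surjective b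
      have h := ih fun k => (M k).cons (x k) (a k)
      rw [ultraTuple_cons] at h
      filter_upwards [h.eventually_lt_const hb] with k hk
      exact (iInf_le _ _).trans_lt hk
  | sup s ψ ih =>
    simp only [Formula.eval]
    refine tendsto_order.2 ⟨fun c hc => ?_, fun c hc => ?_⟩
    · obtain ⟨b, hb⟩ := lt_iSup_iff.1 hc
      obtain ⟨x, rfl⟩ := ofSeq_surjective b
      have h := ih fun k => (M k).cons (x k) (a k)
      rw [ultraTuple_cons] at h
      filter_upwards [h.eventually_const_lt hb] with k hk
      exact hk.trans_le (le_iSup (fun b => ψ.eval (M k) ((M k).cons b (a k))) _)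
    · obtain ⟨c', hc', hcc'⟩ := exists_between hc
      by_contra hn
      rw [← Ultrafilter.eventually_not] at hn
      have : ∀ k, ∃ b : (M k).carrier s, c' < (⨆ b, ψ.eval (M k) ((M k).cons b (a k))) →
          c' < ψ.eval (M k) ((M k).cons b (a k)) := fun k => by
        by_cases h : c' < (⨆ b, ψ.eval (M k) ((M k).cons b (a k)))
        · obtain ⟨b, hb⟩ := lt_iSup_iff.1 h
          exact ⟨b, fun _ => hb⟩
        · exact ⟨Classical.choice ((M k).nonempty s), fun h' => absurd h' h⟩
      choose b hb using this
      have h := ih fun k => (M k).cons (b k) (a k)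
      rw [ultraTuple_cons] at h
      refine absurd ((le_iSup (fun b => ψ.eval (ultraproduct M)
        ((ultraproduct M).cons b (ultraTuple M a))) (ofSeq b)).trans_lt hc')
        (not_lt.2 (ge_of_tendsto h ?_))
      filter_upwards [hn] with k hk
      exact (hb k (hcc'.trans_le (not_lt.1 hk))).le

theorem models_ultraproduct {T : Theory L F} (hM : ∀ k, (M k).Models T) :
    (ultraproduct M).Models T := by
  intro ψ hψ
  have h := tendsto_eval_ultraTuple M ψ fun k v => v.elim
  have e : (ultraTuple M fun k (v : Empty) => (v.elim : (M k).carrier (Empty.elim v))) =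
      fun v => v.elim := funext fun v => v.elim
  rw [e] at h
  refine tendsto_nhds_unique h ?_
  simp only [hM _ ψ hψ]
  exact tendsto_const_nhds

end MStructure

/-- Sequences of pairs in a sequence of models have a limit in some model. -/
theorem exists_model_tendsto {T : Theory L F} {m n : ℕ} {sx : Fin m → L.Sorts}
    {sy : Fin n → L.Sorts} (φ : Formula L F (Sum.elim sx sy)) (M : ℕ → MStructure.{u, w} L)
    (hM : ∀ k, (M k).Models T) {ι : Type*} (a : ∀ k, ι → (M k).Tuple sx)
    (b : ∀ k, ι → (M k).Tuple sy) :
    ∃ (M' : MStructure.{u, w} L) (a' : ι → M'.Tuple sx) (b' : ι → M'.Tuple sy), M'.Models T ∧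
      ∀ i j, Tendsto (fun k => (φ.eval (M k) ((M k).pair (a k i) (b k j)) : ℝ))
        (hyperfilter ℕ : Filter ℕ) (𝓝 (φ.eval M' (M'.pair (a' i) (b' j)) : ℝ)) := by
  refine ⟨MStructure.ultraproduct M, fun i => MStructure.ultraTuple M fun k => a k i,
    fun j => MStructure.ultraTuple M fun k => b k j, MStructure.models_ultraproduct M hM,
    fun i j => ?_⟩
  rw [← MStructure.ultraTuple_pair]
  exact (continuous_subtype_val.tendsto _).comp (MStructure.tendsto_eval_ultraTuple M φ _)

/-! ### Connectives generated by a full system, applied to formulae -/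

section Formulae

theorem ConnSystem.Closure.exists_formula {k : ℕ} {f : C(Fin k → unitInterval, unitInterval)}
    (hf : F.Closure k f) {V : Type} {σ : V → L.Sorts} (ψ : Fin k → Formula L F σ) :
    ∃ χ : Formula L F σ, ∀ (M : MStructure.{u, w} L) (a : M.Tuple σ),
      χ.eval M a = f fun i => (ψ i).eval M a := by
  -- The arity is an index of `Closure`, so the formulae are indexed by a separate `l` equal to it
  -- to keep them general in the induction.
  suffices ∀ {l : ℕ} (ψ : Fin l → Formula L F σ) {k : ℕ}
      {f : C(Fin k → unitInterval, unitInterval)}, F.Closure k f → ∀ h : k = l,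
      ∃ χ : Formula L F σ, ∀ (M : MStructure.{u, w} L) (a : M.Tuple σ),
        χ.eval M a = f fun i => (ψ (Fin.cast h i)).eval M a from this ψ hf rfl
  intro l ψ k f hf
  induction hf generalizing l with
  | basic f hf => exact fun h => ⟨.conn f hf fun i => ψ (Fin.cast h i), fun _ _ => rfl⟩
  | proj i => exact fun h => ⟨ψ (Fin.cast h i), fun _ _ => rfl⟩
  | comp f g _ _ ihf ihg =>
    intro h
    choose θ hθ using fun i => ihg i ψ h
    obtain ⟨χ, hχ⟩ := ihf θ rfl
    refine ⟨χ, fun M a => ?_⟩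
    rw [hχ]
    simp only [Fin.cast_eq_self, hθ]
    rfl

theorem ConnSystem.Full.exists_formula_near (hF : F.Full) {k : ℕ} (hk : 0 < k)
    (f : C(Fin k → unitInterval, unitInterval)) {δ : ℝ} (hδ : 0 < δ) {V : Type} {σ : V → L.Sorts}
    (ψ : Fin k → Formula L F σ) :
    ∃ χ : Formula L F σ, ∀ (M : MStructure.{u, w} L) (a : M.Tuple σ),
      dist (χ.eval M a) (f fun i => (ψ i).eval M a) < δ := by
  obtain ⟨g, hg, hfg⟩ := (hF k hk).exists_dist_lt f hδ
  obtain ⟨χ, hχ⟩ := ConnSystem.Closure.exists_formula.{u, w} (F := F) hg ψ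
  refine ⟨χ, fun M a => ?_⟩
  rw [hχ, dist_comm]
  exact (ContinuousMap.dist_apply_le_dist _).trans_lt hfg

/-! ### Reflecting approximate solutions in an elementary extension -/

/-- A strict upper bound on an infimum is the same as a witness, so the variables of `x` are bound
by `inf` one by one until only parameters in `M` remain, where elementarity applies. -/
theorem ElemEmbedding.exists_eval_lt {M N : MStructure.{u, w} L} (h : ElemEmbedding F M N)
    {m : ℕ} : ∀ {sx : Fin m → L.Sorts} {W : Type} {τ : W → L.Sorts}
    (ψ : Formula L F (Sum.elim sx τ)) (b : M.Tuple τ) (r : unitInterval) (a : N.Tuple sx),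
    ψ.eval N (N.pair a fun i => h.toFun _ (b i)) < r → ∃ a' : M.Tuple sx,
      ψ.eval M (M.pair a' b) < r := by
  induction m with
  | zero =>
    intro sx W τ ψ b r a hr
    refine ⟨fun i => i.elim0, ?_⟩
    rw [← h.map_eval]
    convert hr using 2
    funext v
    rcases v with i | w
    · exact i.elim0
    · rfl
  | succ m ih =>
    intro sx W τ ψ b r a hr
    let e : ∀ v : Fin (m + 1) ⊕ W, Term L (extSort (Sum.elim (fun i : Fin m => sx i.succ) τ) (sx 0))
        (Sum.elim sx τ v) := fun v => match v with
      | .inl i => Fin.cases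
          (motive := fun i => Term L (extSort (Sum.elim (fun i : Fin m => sx i.succ) τ) (sx 0))
            (sx i))
          (Term.var none : Term L (extSort _ _) (extSort _ _ none))
          (fun j => (Term.var (some (Sum.inl j)) :
            Term L (extSort _ _) (extSort (Sum.elim (fun i : Fin m => sx i.succ) τ) (sx 0)
              (some (Sum.inl j))))) i
      | .inr w => (Term.var (some (Sum.inr w)) :
            Term L (extSort _ _) (extSort (Sum.elim (fun i : Fin m => sx i.succ) τ) (sx 0)
              (some (Sum.inr w))))
    have he : ∀ (K : MStructure.{u, w} L) (a : K.Tuple sx) (b : K.Tuple τ),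
        (ψ.subst e).eval K (K.cons (a 0) (K.pair (fun i : Fin m => a i.succ) b)) =
          ψ.eval K (K.pair a b) := fun K a b => by
      rw [Formula.eval_subst]
      congr 1
      funext v
      rcases v with i | w
      · cases i using Fin.cases <;> rfl
      · rfl
    obtain ⟨a', ha'⟩ := ih (Formula.inf (sx 0) (ψ.subst e)) b r (fun i => a i.succ)
      (iInf_lt_iff.2 ⟨a 0, by rwa [he]⟩)
    obtain ⟨a₀, ha₀⟩ := iInf_lt_iff.1 ha'
    refine ⟨Fin.cons (α := fun i => M.carrier (sx i)) a₀ a', ?_⟩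
    rw [← he]
    simpa using ha₀

/-- Finitely many values `ψ_i(a, b_i)` at a tuple of an elementary extension of `M` are approximated
at a tuple of `M`. -/
theorem ElemEmbedding.exists_forall_dist_lt (hF : F.Full) {M N : MStructure.{u, w} L}
    (h : ElemEmbedding F M N) {m : ℕ} {sx : Fin m → L.Sorts} (a : N.Tuple sx) {k : ℕ}
    (ψ : Fin k → ParamFormula F M sx) {δ : ℝ} (hδ : 0 < δ) :
    ∃ a' : M.Tuple sx, ∀ i, dist ((ψ i).formula.eval M (M.pair a' (ψ i).params))
      ((ψ i).formula.eval N (N.pair a fun j => h.toFun _ ((ψ i).params j))) < δ := by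
  -- Fullness concerns positive arities only.
  rcases Nat.eq_zero_or_pos k with rfl | hk
  · exact ⟨fun i => Classical.choice (M.nonempty _), fun i => i.elim0⟩
  let r : Fin k → unitInterval := fun i =>
    (ψ i).formula.eval N (N.pair a fun j => h.toFun _ ((ψ i).params j))
  -- The separate parameter tuples are merged into one.
  let τ : (Σ i, Fin (ψ i).k) → L.Sorts := fun p => (ψ p.1).sorts p.2
  let b : M.Tuple τ := fun p => (ψ p.1).params p.2
  let θ : Fin k → Formula L F (Sum.elim sx τ) := fun i => (ψ i).formula.subst fun v => match v with
    | .inl j => (Term.var (Sum.inl j) : Term L (Sum.elim sx τ) (Sum.elim sx τ (Sum.inl j)))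
    | .inr j => (Term.var (Sum.inr (⟨i, j⟩ : Σ i, Fin (ψ i).k)) :
        Term L (Sum.elim sx τ) (Sum.elim sx τ (Sum.inr (⟨i, j⟩ : Σ i, Fin (ψ i).k))))
  have hθ : ∀ (K : MStructure.{u, w} L) (a : K.Tuple sx) (b : K.Tuple τ) (i : Fin k),
      (θ i).eval K (K.pair a b) = (ψ i).formula.eval K (K.pair a fun j => b (⟨i, j⟩ : Σ i, Fin (ψ i).k)) :=
    fun K a b i => by
      refine (Formula.eval_subst K _ _ _).trans ?_
      congr 1
      funext v
      rcases v with j | j <;> rfl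
  -- The target values `r` are absorbed into the connective, which vanishes exactly at `r`. Its
  -- approximation by a formula costs `δ'` in `N` and again in `M`, hence `2 * δ' ≤ δ`.
  let f : C(Fin k → unitInterval, unitInterval) :=
    ⟨fun t => (⟨dist t r, dist_nonneg, (dist_pi_le_iff zero_le_one).2 fun i => by
        rw [Subtype.dist_eq, Real.dist_eq, abs_le]
        constructor <;> linarith [(t i).2.1, (t i).2.2, (r i).2.1, (r i).2.2]⟩ : unitInterval),
      (continuous_id.dist continuous_const).subtype_mk _⟩
  obtain ⟨δ', hδ', hδ₁, hδ₂⟩ : ∃ δ' : ℝ, 0 < δ' ∧ δ' ≤ 1 ∧ 2 * δ' ≤ δ :=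
    ⟨min 1 (δ / 2), by positivity, min_le_left _ _, by linarith [min_le_right 1 (δ / 2)]⟩
  obtain ⟨χ, hχ⟩ := hF.exists_formula_near hk f hδ' θ
  have hN : χ.eval N (N.pair a fun i => h.toFun _ (b i)) < ⟨δ', hδ'.le, hδ₁⟩ := by
    have h₁ := hχ N (N.pair a fun i => h.toFun _ (b i))
    have h₂ : (f fun i => (θ i).eval N (N.pair a fun i => h.toFun _ (b i)) : unitInterval) = 0 := by
      refine Subtype.ext ?_
      simp only [hθ]
      exact dist_self r
    rw [h₂, Subtype.dist_eq, Real.dist_eq] at h₁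
    have := (abs_lt.1 h₁).2
    simp only [Set.Icc.coe_zero, sub_zero] at this
    exact this
  obtain ⟨a', ha'⟩ := h.exists_eval_lt χ b _ a hN
  refine ⟨a', fun i => ?_⟩
  have h₁ := hχ M (M.pair a' b)
  rw [Subtype.dist_eq, Real.dist_eq] at h₁
  have h₂ : (χ.eval M (M.pair a' b) : ℝ) < δ' := ha'
  have h₃ : dist (fun i => (θ i).eval M (M.pair a' b)) r < 2 * δ' := by
    have := (abs_lt.1 h₁).1
    change -δ' < (χ.eval M (M.pair a' b) : ℝ) - dist (fun i => (θ i).eval M (M.pair a' b)) r at this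
    linarith
  have h₄ := (dist_le_pi_dist (fun i => (θ i).eval M (M.pair a' b)) r i).trans_lt h₃
  simp only [hθ] at h₄
  exact h₄.trans_le hδ₂

/-- The types of tuples of `M` are dense in the space of types over `M`. -/
theorem denseRange_tp (hF : F.Full) (M : MStructure.{u, w} L) {m : ℕ} (sx : Fin m → L.Sorts) :
    DenseRange (tp F M : M.Tuple sx → TypeSpace F M sx) := by
  classical
  refine fun q => mem_closure_iff_nhds.2 fun U hU => ?_
  obtain ⟨V, hV, hVU⟩ := (mem_nhds_induced Subtype.val q U).1 hU
  obtain ⟨N, h, a, hp⟩ := q.2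
  rw [nhds_pi, Filter.mem_pi] at hV
  obtain ⟨I, hI, t, ht, hIt⟩ := hV
  choose! δ hδ hδt using fun ψ => Metric.mem_nhds_iff.1 (ht ψ)
  lift I to Finset (ParamFormula F M sx) using hI
  obtain ⟨ε, hε, hεδ⟩ : ∃ ε : ℝ, 0 < ε ∧ ∀ ψ ∈ I, ε ≤ δ ψ := by
    rcases I.eq_empty_or_nonempty with rfl | hne
    · exact ⟨1, one_pos, by simp⟩
    · exact ⟨I.inf' hne δ, (Finset.lt_inf'_iff hne).2 fun ψ _ => hδ ψ,
        fun ψ hψ => Finset.inf'_le _ hψ⟩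
  obtain ⟨a', ha'⟩ := h.exists_forall_dist_lt hF a
    (fun i => (I.equivFin.symm i : ParamFormula F M sx)) hε
  have ha'' : ∀ ψ ∈ I, dist (ψ.formula.eval M (M.pair a' ψ.params))
      (ψ.formula.eval N (N.pair a fun j => h.toFun _ (ψ.params j))) < ε := fun ψ hψ => by
    obtain ⟨i, hi⟩ := I.equivFin.symm.surjective ⟨ψ, hψ⟩
    have := ha' i
    rwa [hi] at this
  refine ⟨tp F M a', hVU (hIt fun ψ hψ => hδt ψ ?_), a', rfl⟩
  have := (ha'' ψ hψ).trans_le (hεδ ψ hψ)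
  rw [← hp ψ] at this
  exact this

end Formulae

/-! ### Consequences of stability -/

/-- Iterated limits of an alternating array, and subsequences along which they are approximated. -/
theorem exists_iterated_limits (f : ℕ → ℕ → unitInterval) {ε : ℝ}
    (hf : ∀ i j k, i < j → j < k → ε ≤ |(f j i : ℝ) - f j k|) :
    ∃ r s : unitInterval, ε ≤ |(r : ℝ) - s| ∧ ∀ δ : ℝ, 0 < δ → ∃ n : ℕ → ℕ, ∀ i j, i < j →
      dist (f (n j) (n i)) r < δ ∧ dist (f (n i) (n j)) s < δ := by
  -- The gap survives three successive limits: in the last index, then the middle one, then the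
  -- first.
  let g : ℕ → unitInterval := fun i => ulim fun j => f j i
  let h : ℕ → unitInterval := fun j => ulim (f j)
  have hlarge : ∀ i, ∀ᶠ j in (hyperfilter ℕ : Filter ℕ), i < j := fun i =>
    Nat.hyperfilter_le_atTop (eventually_gt_atTop i)
  have h₁ : ∀ i j, i < j → ε ≤ |(f j i : ℝ) - h j| := fun i j hij =>
    ge_of_tendsto ((tendsto_const_nhds.sub (tendsto_ulim_coe (f j))).abs)
      ((hlarge j).mono fun k hk => hf i j k hij hk)
  have h₂ : ∀ i, ε ≤ |(g i : ℝ) - ulim h| := fun i =>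
    ge_of_tendsto (((tendsto_ulim_coe fun j => f j i).sub (tendsto_ulim_coe h)).abs)
      ((hlarge i).mono fun j hj => h₁ i j hj)
  refine ⟨ulim g, ulim h,
    ge_of_tendsto' (((tendsto_ulim_coe g).sub tendsto_const_nhds).abs) h₂, fun δ hδ => ?_⟩
  -- Each new index satisfies finitely many conditions that hold on large sets, provided that all
  -- earlier indices have `g` and `h` already near their limits.
  obtain ⟨n, -, hn⟩ := exists_seq_of_forall_finset_exists
    (fun x => dist (g x) (ulim g) < δ ∧ dist (h x) (ulim h) < δ)
    (fun x y => dist (f y x) (ulim g) < δ ∧ dist (f x y) (ulim h) < δ) fun S hS => by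
      have e₁ : ∀ᶠ y in (hyperfilter ℕ : Filter ℕ),
          dist (g y) (ulim g) < δ ∧ dist (h y) (ulim h) < δ :=
        ((tendsto_ulim g).eventually (Metric.ball_mem_nhds _ hδ)).and
          ((tendsto_ulim h).eventually (Metric.ball_mem_nhds _ hδ))
      have e₂ : ∀ᶠ y in (hyperfilter ℕ : Filter ℕ), ∀ x ∈ S,
          dist (f y x) (ulim g) < δ ∧ dist (f x y) (ulim h) < δ := by
        refine (Filter.eventually_all_finset S).2 fun x hx => ?_
        exact ((tendsto_ulim fun j => f j x).eventually
          (Metric.isOpen_ball.mem_nhds (hS x hx).1)).and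
          ((tendsto_ulim (f x)).eventually (Metric.isOpen_ball.mem_nhds (hS x hx).2))
      exact (e₁.and e₂).exists
  exact ⟨n, hn⟩

section Stability

variable {T : Theory L F} {m n : ℕ} {sx : Fin m → L.Sorts}
  {sy : Fin n → L.Sorts} {φ : Formula L F (Sum.elim sx sy)} {ε : ℝ}

theorem tendsto_one_div_hyperfilter :
    Tendsto (fun k : ℕ => 1 / ((k : ℝ) + 1)) (hyperfilter ℕ : Filter ℕ) (𝓝 0) :=
  tendsto_one_div_add_atTop_nhds_zero_nat.mono_left Nat.hyperfilter_le_atTop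

/-- Alternating sequences of all finite lengths yield an infinite one in some model. -/
theorem exists_alternating_seq (h : ∀ N : ℕ, ¬ NoAlternation.{u, w} T φ ε (N + 1)) :
    ∃ (M : MStructure.{u, w} L) (a : ℕ → M.Tuple sx) (b : ℕ → M.Tuple sy), M.Models T ∧
      ∀ i j k, i < j → j < k →
        ε ≤ |(φ.eval M (M.pair (a j) (b i)) : ℝ) - φ.eval M (M.pair (a j) (b k))| := by
  simp only [NoAlternation, not_forall, not_not] at h
  choose M hM a b hab using h
  -- Finite sequences are extended periodically; for `N ≥ k` the indices up to `k` do not wrap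
  -- around.
  obtain ⟨M', a', b', hM', hl⟩ := exists_model_tendsto φ M hM
    (fun N (i : ℕ) => a N (Fin.ofNat _ i)) (fun N (i : ℕ) => b N (Fin.ofNat _ i))
  refine ⟨M', a', b', hM', fun i j k hij hjk => ?_⟩
  refine ge_of_tendsto ((hl j i).sub (hl j k)).abs ?_
  filter_upwards [Nat.hyperfilter_le_atTop (eventually_ge_atTop k)] with N hN
  refine hab N _ _ _ ?_ ?_
  · rw [Fin.lt_def, Fin.val_ofNat, Fin.val_ofNat, Nat.mod_eq_of_lt (by omega),
      Nat.mod_eq_of_lt (by omega)]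
    exact hij
  · rw [Fin.lt_def, Fin.val_ofNat, Fin.val_ofNat, Nat.mod_eq_of_lt (by omega),
      Nat.mod_eq_of_lt (by omega)]
    exact hjk

/-- Along the subsequences for `δ = 1 / (k + 1)`, the values below and above the diagonal tend to
`r` and `s`. In the ultraproduct they equal `r` and `s`, so no part of `ε` is lost. -/
theorem EpsStable.exists_noAlternation (h : EpsStable.{u, w} T φ ε) :
    ∃ N : ℕ, NoAlternation.{u, w} T φ ε (N + 1) := by
  by_contra! hN
  obtain ⟨M, a, b, hM, hab⟩ := exists_alternating_seq hN
  obtain ⟨r, s, hrs, H⟩ := exists_iterated_limits (fun i j => φ.eval M (M.pair (a i) (b j))) hab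
  choose ν hν using fun k : ℕ => H (1 / ((k : ℝ) + 1)) Nat.one_div_pos_of_nat
  obtain ⟨M', a', b', hM', hl⟩ := exists_model_tendsto φ (fun _ => M) (fun _ => hM)
    (fun k i => a (ν k i)) (fun k i => b (ν k i))
  refine h M' hM' ⟨a', b', fun i j hij => ?_⟩
  have h₁ : (φ.eval M' (M'.pair (a' j) (b' i)) : ℝ) = r := by
    refine tendsto_nhds_unique (hl j i) (tendsto_iff_dist_tendsto_zero.2 ?_)
    exact squeeze_zero (fun _ => dist_nonneg) (fun k => (hν k i j hij).1.le)
      tendsto_one_div_hyperfilter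
  have h₂ : (φ.eval M' (M'.pair (a' i) (b' j)) : ℝ) = s := by
    refine tendsto_nhds_unique (hl i j) (tendsto_iff_dist_tendsto_zero.2 ?_)
    exact squeeze_zero (fun _ => dist_nonneg) (fun k => (hν k i j hij).2.le)
      tendsto_one_div_hyperfilter
  rw [h₁, h₂, abs_sub_comm]
  exact hrs

theorem NoAlternation.exists_sub {N : ℕ} (h : NoAlternation.{u, w} T φ ε N) :
    ∃ η : ℝ, 0 < η ∧ NoAlternation.{u, w} T φ (ε - η) N := by
  by_contra! hN
  have hk := fun k : ℕ => hN (1 / ((k : ℝ) + 1)) Nat.one_div_pos_of_nat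
  simp only [NoAlternation, not_forall, not_not] at hk
  choose M hM a b hab using hk
  obtain ⟨M', a', b', hM', hl⟩ := exists_model_tendsto φ M hM a b
  refine h M' hM' ⟨a', b', fun i j k hij hjk => ?_⟩
  have hε : Tendsto (fun k : ℕ => ε - 1 / ((k : ℝ) + 1)) (hyperfilter ℕ : Filter ℕ) (𝓝 (ε - 0)) :=
    tendsto_const_nhds.sub tendsto_one_div_hyperfilter
  rw [sub_zero] at hε
  exact le_of_tendsto_of_tendsto' hε ((hl j i).sub (hl j k)).abs fun l => hab l i j k hij hjk

theorem EpsStable.isLeast_stabN (h : EpsStable.{u, w} T φ ε) :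
    IsLeast {N : ℕ | NoAlternation.{u, w} T φ ε (N + 1)} (stabN.{u, w} T φ ε) :=
  ⟨Nat.sInf_mem h.exists_noAlternation, fun _ => Nat.sInf_le⟩

end Stability

/-! ### Approximation by median values -/

/-- Otherwise at least `n` of the `2n - 1` values are at most `c`, and their maximum bounds the
median. -/
theorem exists_card_eq_of_lt_med {n : ℕ} {t : Fin (2 * n - 1) → unitInterval} {c : ℝ}
    (h : c < med n t) : ∃ w : Finset (Fin (2 * n - 1)), w.card = n ∧ ∀ i ∈ w, c < t i := by
  classical
  by_cases hn : n ≤ (Finset.univ.filter fun i => c < t i).card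
  · obtain ⟨w, hw, hwn⟩ := Finset.exists_subset_card_eq hn
    exact ⟨w, hwn, fun i hi => (Finset.mem_filter.1 (hw hi)).2⟩
  · exfalso
    have hc := Finset.card_filter_add_card_filter_not (s := Finset.univ) fun i => c < t i
    rw [Finset.card_univ, Fintype.card_fin] at hc
    obtain ⟨w, hw, hwn⟩ := Finset.exists_subset_card_eq
      (show n ≤ (Finset.univ.filter fun i => ¬ c < t i).card by omega)
    obtain ⟨i, hi, hit⟩ := Finset.exists_mem_eq_sup w (Finset.card_pos.1 (by omega)) t
    have h₁ : med n t ≤ w.sup t :=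
      Finset.inf_le (f := fun w : Finset (Fin (2 * n - 1)) => w.sup t)
        (Finset.mem_powersetCard.2 ⟨Finset.subset_univ _, hwn⟩)
    rw [hit] at h₁
    exact (Finset.mem_filter.1 (hw hi)).2 (h.trans_le h₁)

theorem exists_card_eq_of_med_lt {n : ℕ} {t : Fin (2 * n - 1) → unitInterval} {c : ℝ}
    (hn : 0 < n) (h : (med n t : ℝ) < c) :
    ∃ w : Finset (Fin (2 * n - 1)), w.card = n ∧ ∀ i ∈ w, (t i : ℝ) < c := by
  obtain ⟨w, hw, hwt⟩ := Finset.exists_mem_eq_inf (Finset.univ.powersetCard n)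
    (Finset.powersetCard_nonempty.2 (by rw [Finset.card_univ, Fintype.card_fin]; omega))
    fun w : Finset (Fin (2 * n - 1)) => w.sup t
  refine ⟨w, (Finset.mem_powersetCard.1 hw).2, fun i hi => lt_of_le_of_lt ?_ h⟩
  rw [med, hwt]
  exact Finset.le_sup (f := t) hi

section Median

variable {A B : Type*}

/-- A choice of near minimizers of `g` among the points where all `f a`, `a ∈ s`, exceed `g + ε`. -/
theorem exists_near_minimizer [Nonempty B] (f : A → B → ℝ) (g : B → ℝ)
    (hg : BddBelow (Set.range g)) (ε : ℝ) {δ : ℝ} (hδ : 0 < δ) :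
    ∃ β : Finset A → B, ∀ s b, (∀ a ∈ s, g b + ε < f a b) →
      (∀ a ∈ s, g (β s) + ε < f a (β s)) ∧ g (β s) ≤ g b + δ := by
  have : ∀ s : Finset A, ∃ b₀, ∀ b, (∀ a ∈ s, g b + ε < f a b) →
      (∀ a ∈ s, g b₀ + ε < f a b₀) ∧ g b₀ ≤ g b + δ := fun s => by
    let D : Set B := {b | ∀ a ∈ s, g b + ε < f a b}
    rcases D.eq_empty_or_nonempty with hD | hD
    · exact ⟨Classical.arbitrary B, fun b hb => absurd (show b ∈ D from hb) (by simp [hD])⟩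
    · obtain ⟨_, ⟨b₀, hb₀, rfl⟩, hlt⟩ := exists_lt_of_csInf_lt (hD.image g)
        (lt_add_of_pos_right (sInf (g '' D)) hδ)
      refine ⟨b₀, fun b hb => ⟨hb₀, hlt.le.trans ?_⟩⟩
      gcongr
      exact csInf_le (hg.mono (Set.image_subset_range _ _)) ⟨b, hb, rfl⟩
  choose β hβ using this
  exact ⟨β, hβ⟩

/-- The finite sets of values of the sequence `c n = G {c i | i < n}`. -/
def greedySet [DecidableEq A] (G : Finset A → A) : ℕ → Finset A
  | 0 => ∅
  | n + 1 => insert (G (greedySet G n)) (greedySet G n)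

theorem greedySet_mono [DecidableEq A] (G : Finset A → A) : Monotone (greedySet G) :=
  monotone_nat_of_le_succ fun _ => Finset.subset_insert _ _

theorem mem_greedySet [DecidableEq A] (G : Finset A → A) {i j : ℕ} (hij : i < j) :
    G (greedySet G i) ∈ greedySet G j :=
  greedySet_mono G hij (Finset.mem_insert_self _ _)

/-- A large deviation at `N` points of a sequence approximating `g` yields an alternating
sequence. -/
theorem exists_alternating_of_deviation [DecidableEq A] {f : A → B → ℝ} {g : B → ℝ} {ε δ : ℝ}
    {β : Finset A → B} (hβ : ∀ s b, (∀ a ∈ s, g b + ε < f a b) →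
      (∀ a ∈ s, g (β s) + ε < f a (β s)) ∧ g (β s) ≤ g b + δ)
    {G : Finset A → A} (hG : ∀ s t, t ⊆ s → |f (G s) (β t) - g (β t)| ≤ δ) {K N : ℕ}
    {w : Finset (Fin K)} (hw : w.card = N) {b : B}
    (hb : ∀ i ∈ w, g b + ε < f (G (greedySet G i)) b) :
    ∃ (a : Fin (N + 1) → A) (b' : Fin (N + 1) → B), ∀ i j k, i < j → j < k →
      ε - 3 * δ ≤ f (a j) (b' k) - f (a j) (b' i) := by
  let e : Fin N ↪o Fin K := w.orderEmbOfFin hw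
  let c : Fin N → A := fun j => G (greedySet G (e j))
  -- The first `l` deviating points; their near-minimizers `β (s l)`, `l ≤ N`, are the second half
  -- of the alternating sequence.
  let s : ℕ → Finset A := fun l => (Finset.univ.filter fun j : Fin N => (j : ℕ) < l).image c
  have hs : ∀ {i k}, i ≤ k → s i ⊆ s k := fun {i k} hik =>
    Finset.image_subset_image fun j hj => by
      simp only [Finset.mem_filter, Finset.mem_univ, true_and] at hj ⊢
      omega
  have hsb : ∀ l, ∀ a ∈ s l, g b + ε < f a b := fun l a ha => by
    obtain ⟨j, -, rfl⟩ := Finset.mem_image.1 ha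
    exact hb _ (w.orderEmbOfFin_mem hw j)
  have hsub : ∀ (j : Fin N) (l : ℕ), l ≤ j → s l ⊆ greedySet G (e j) := fun j l hl a ha => by
    obtain ⟨i, hi, rfl⟩ := Finset.mem_image.1 ha
    refine mem_greedySet G (e.strictMono ?_)
    have := (Finset.mem_filter.1 hi).2
    exact Fin.lt_def.2 (by omega)
  -- The last `a` is arbitrary, as the middle index `j < k` never equals `N`.
  refine ⟨fun j => if h : (j : ℕ) < N then c ⟨j, h⟩ else G ∅, fun l => β (s l),
    fun i j k hij hjk => ?_⟩
  rw [Fin.lt_def] at hij hjk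
  have hj : (j : ℕ) < N := by omega
  simp only [hj, dif_pos]
  -- At `β (s i)` the later point `c j` is close to `g`; at `β (s k)` it exceeds `g` by `ε`, as `c j
  -- ∈ s k`. Since `s i ⊆ s k`, `β (s k)` competes in the minimization for `s i`, so `g` is not much
  -- larger at `β (s i)`.
  have h₁ := (abs_le.1 (hG _ _ (hsub ⟨j, hj⟩ i hij.le))).2
  have h₂ := (hβ (s k) b (hsb k)).1
  have h₃ := h₂ (c ⟨j, hj⟩) (Finset.mem_image_of_mem c (by simpa using hjk))
  have h₄ := (hβ (s i) (β (s k)) fun a ha => h₂ a (hs (hij.trans hjk).le ha)).2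
  have hδ : 0 ≤ δ := (abs_nonneg _).trans (hG ∅ ∅ (Finset.Subset.refl _))
  change ε - 3 * δ ≤ f (c ⟨j, hj⟩) (β (s k)) - f (c ⟨j, hj⟩) (β (s i))
  change f (c ⟨j, hj⟩) (β (s i)) - g (β (s i)) ≤ δ at h₁
  linarith

/-- If `g` is finitely approximated by the functions `f a`, and these have no alternating sequence
of length `N + 1`, then `g` is uniformly approximated by a median value of some of the `f a`. -/
theorem exists_med_near [Nonempty B] (f : A → B → unitInterval) (g : B → unitInterval)
    (hfg : ∀ (t : Finset B) (δ : ℝ), 0 < δ → ∃ a, ∀ b ∈ t, |(f a b : ℝ) - g b| ≤ δ) {N : ℕ}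
    (hN₀ : 0 < N) {ε η : ℝ} (hη : 0 < η)
    (hN : ¬ ∃ (a : Fin (N + 1) → A) (b : Fin (N + 1) → B), ∀ i j k, i < j → j < k →
      ε - η ≤ |(f (a j) (b i) : ℝ) - f (a j) (b k)|) :
    ∃ c : Fin (2 * N - 1) → A, ∀ b, |(g b : ℝ) - med N fun i => f (c i) b| ≤ ε := by
  classical
  have hδ : 0 < η / 3 := by positivity
  obtain ⟨β, hβ⟩ := exists_near_minimizer (fun a b => (f a b : ℝ)) (fun b => (g b : ℝ))
    ⟨0, by rintro _ ⟨b, rfl⟩; exact (g b).2.1⟩ ε hδ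
  -- Negating `f` and `g` treats downward deviations in the same way.
  obtain ⟨γ, hγ⟩ := exists_near_minimizer (fun a b => -(f a b : ℝ)) (fun b => -(g b : ℝ))
    ⟨-1, by rintro _ ⟨b, rfl⟩; exact neg_le_neg (g b).2.2⟩ ε hδ
  -- Which points will deviate is not known in advance, so all subsets of the points chosen so far
  -- are tested, for both directions.
  choose G hG using fun s : Finset A => hfg (s.powerset.image β ∪ s.powerset.image γ) (η / 3) hδ
  have hGβ : ∀ s t, t ⊆ s → |(f (G s) (β t) : ℝ) - g (β t)| ≤ η / 3 := fun s t hts =>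
    hG s _ (Finset.mem_union_left _ (Finset.mem_image_of_mem _ (Finset.mem_powerset.2 hts)))
  have hGγ : ∀ s t, t ⊆ s → |-(f (G s) (γ t) : ℝ) - -(g (γ t) : ℝ)| ≤ η / 3 := fun s t hts => by
    rw [neg_sub_neg, abs_sub_comm]
    exact hG s _ (Finset.mem_union_right _ (Finset.mem_image_of_mem _ (Finset.mem_powerset.2 hts)))
  refine ⟨fun i => G (greedySet G i), fun b => abs_le.2 ⟨?_, ?_⟩⟩
  · by_contra! h
    obtain ⟨w, hw, hwb⟩ := exists_card_eq_of_lt_med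
      (show (g b : ℝ) + ε < med N fun i => f (G (greedySet G i)) b by linarith)
    obtain ⟨a, b', hab⟩ := exists_alternating_of_deviation hβ hGβ hw hwb
    refine hN ⟨a, b', fun i j k hij hjk => ?_⟩
    rw [abs_sub_comm]
    refine le_trans ?_ ((hab i j k hij hjk).trans (le_abs_self _))
    linarith
  · by_contra! h
    obtain ⟨w, hw, hwb⟩ := exists_card_eq_of_med_lt hN₀
      (show ((med N fun i => f (G (greedySet G i)) b : unitInterval) : ℝ) < g b - ε by linarith)
    obtain ⟨a, b', hab⟩ := exists_alternating_of_deviation hγ hGγ hw (b := b)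
      fun i hi => by linarith [hwb i hi]
    refine hN ⟨a, b', fun i j k hij hjk => ?_⟩
    refine le_trans ?_ ((hab i j k hij hjk).trans ((le_of_eq ?_).trans (le_abs_self _))) <;> ring_nf
    exact le_rfl

end Median

/-! ### Forced limits -/

/-- Written as a truncation, the recursion is visibly continuous in the sequence. -/
theorem flimSeq_succ (a : ℕ → unitInterval) (k : ℕ) :
    flimSeq a (k + 1) = max (flimSeq a k - 2⁻¹ ^ (k + 1))
      (min (flimSeq a k + 2⁻¹ ^ (k + 1)) (a (k + 1))) := by
  have hp : (0 : ℝ) < 2⁻¹ ^ (k + 1) := by positivity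
  rw [flimSeq]
  split_ifs with h₁ h₂
  · rw [min_eq_left h₁, max_eq_right (by linarith)]
  · rw [min_eq_right (by linarith), max_eq_left h₂]
  · rw [min_eq_right (by linarith), max_eq_right (by linarith)]

theorem dist_flimSeq_flim_le (a : ℕ → unitInterval) (k : ℕ) :
    dist (flimSeq a k) (flim a) ≤ 1 / 2 ^ k :=
  dist_le_of_le_geometric_two_of_tendsto (dist_flimSeq_le a) (tendsto_flim a) k

theorem tendsto_one_div_two_pow : Tendsto (fun k : ℕ => 1 / (2 : ℝ) ^ k) atTop (𝓝 0) := by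
  simpa [one_div, inv_pow] using
    tendsto_pow_atTop_nhds_zero_of_lt_one (r := (2⁻¹ : ℝ)) (by norm_num) (by norm_num)

theorem continuous_flim {X : Type*} [TopologicalSpace X] {a : ℕ → X → unitInterval}
    (ha : ∀ k, Continuous (a k)) : Continuous fun x => flim fun k => a k x := by
  have h : ∀ k, Continuous fun x => flimSeq (fun k => a k x) k := fun k => by
    induction k with
    | zero => exact continuous_subtype_val.comp (ha 0)
    | succ k ih =>
      simp only [flimSeq_succ]
      exact (ih.sub continuous_const).max
        ((ih.add continuous_const).min (continuous_subtype_val.comp (ha (k + 1))))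
  refine continuous_induced_rng.2 (TendstoUniformly.continuous
    (F := fun k x => flimSeq (fun k => a k x) k) (p := atTop) ?_ (Frequently.of_forall h))
  refine Metric.tendstoUniformly_iff.2 fun ε hε => ?_
  filter_upwards [tendsto_one_div_two_pow.eventually_lt_const hε] with k hk x
  rw [dist_comm]
  exact (dist_flimSeq_flim_le _ k).trans_lt hk

/-- The modified sequence also stays within `2^(-k)` of `r`: a truncated step moves by `2^(-k-1)` in
the direction of `a (k + 1)`, enough to halve the error bound. -/
theorem flim_eq_of_abs_sub_le {a : ℕ → unitInterval} {r : unitInterval}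
    (h : ∀ k, |(r : ℝ) - a k| ≤ 2⁻¹ ^ k) : flim a = r := by
  have hk : ∀ k, dist (flimSeq a k) r ≤ 1 / 2 ^ k := fun k => by
    rw [one_div, ← inv_pow, Real.dist_eq, abs_sub_comm]
    induction k with
    | zero => exact h 0
    | succ k ih =>
      have h' := abs_le.1 (h (k + 1))
      have ih' := abs_le.1 ih
      have e : (2⁻¹ : ℝ) ^ k = 2 * 2⁻¹ ^ (k + 1) := by rw [pow_succ]; ring
      rw [flimSeq, abs_le]
      split_ifs <;> constructor <;> linarith
  refine Subtype.ext (tendsto_nhds_unique (tendsto_flim a) (tendsto_iff_dist_tendsto_zero.2 ?_))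
  exact squeeze_zero (fun _ => dist_nonneg) hk tendsto_one_div_two_pow

theorem continuous_med (n : ℕ) : Continuous (med n) := by
  unfold med
  exact Continuous.finset_inf_apply fun w _ =>
    Continuous.finset_sup_apply fun i _ => continuous_apply i

section Definability

variable {T : Theory L F} {m n : ℕ} {sx : Fin m → L.Sorts}
  {sy : Fin n → L.Sorts} {φ : Formula L F (Sum.elim sx sy)} {M : MStructure.{u, w} L}

/-! ### Definability of types -/

theorem TypeSpace.continuous_val (ψ : ParamFormula F M sx) :
    Continuous fun p : TypeSpace F M sx => p.val ψ :=
  (continuous_apply ψ).comp continuous_subtype_val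

theorem continuous_dPhi (C : ∀ k : ℕ, Fin (2 * stabN.{u, w} T φ (2⁻¹ ^ k) - 1) → M.Tuple sx) :
    Continuous (dPhi T φ C) :=
  continuous_flim fun _ => (continuous_med _).comp
    (continuous_pi fun _ => TypeSpace.continuous_val _)

theorem isPhiPred_dPhi (C : ∀ k : ℕ, Fin (2 * stabN.{u, w} T φ (2⁻¹ ^ k) - 1) → M.Tuple sx) :
    IsPhiPred φ.swap (dPhi T φ C) := by
  have h : ∀ q q' : TypeSpace F M sy, (phiSetoid M φ.swap).r q q' →
      dPhi T φ C q = dPhi T φ C q' := fun q q' hq => by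
    unfold dPhi dEps medPhi
    congr 1
    funext k
    congr 1
    funext i
    exact hq _
  exact ⟨Quotient.lift (s := phiSetoid M φ.swap) (dPhi T φ C) h,
    (continuous_dPhi C).quotient_lift h, fun _ => rfl⟩

theorem medPhi_tp (N : ℕ) (c : Fin (2 * N - 1) → M.Tuple sx) (b : M.Tuple sy) :
    medPhi φ N c (tp F M b) = med N fun i => φ.eval M (M.pair (c i) b) := by
  unfold medPhi
  congr 1
  funext i
  exact Formula.eval_swap M φ (c i) b

theorem IsDefinablePred.ext (hF : F.Full) {ψ χ : TypeSpace F M sy → unitInterval}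
    (hψ : IsDefinablePred ψ) (hχ : IsDefinablePred χ) (h : ∀ b, ψ (tp F M b) = χ (tp F M b)) :
    ψ = χ :=
  (denseRange_tp hF M sy).equalizer hψ hχ (funext h)

/-- For length `1` the alternation condition is vacuous, so any model contains such a sequence. -/
theorem NoAlternation.pos {ε : ℝ} {N : ℕ} (h : NoAlternation.{u, w} T φ ε (N + 1))
    (hM : M.Models T) : 0 < N := by
  rcases Nat.eq_zero_or_pos N with rfl | hN
  · refine absurd ⟨fun _ _ => Classical.choice (M.nonempty _),
      fun _ _ => Classical.choice (M.nonempty _), fun i j k hij _ => ?_⟩ (h M hM)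
    rw [Fin.lt_def] at hij
    omega
  · exact hN

theorem EpsStable.exists_dEps_near (hF : F.Full) {ε : ℝ} (h : EpsStable.{u, w} T φ ε)
    (hM : M.Models T) (p : PhiType M φ) :
    ∃ c : Fin (2 * stabN.{u, w} T φ ε - 1) → M.Tuple sx, ∀ b : M.Tuple sy,
      |(p.val b : ℝ) - dEps T φ ε c (tp F M b)| ≤ ε := by
  obtain ⟨q, rfl⟩ := Quotient.exists_rep (s := phiSetoid M φ) p
  obtain ⟨N, j, a, hq⟩ := q.2
  have hstab := h.isLeast_stabN.1
  obtain ⟨η, hη, hN⟩ := NoAlternation.exists_sub hstab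
  have : Nonempty (M.Tuple sy) := ⟨fun _ => Classical.choice (M.nonempty _)⟩
  obtain ⟨c, hc⟩ := exists_med_near (fun (a : M.Tuple sx) b => φ.eval M (M.pair a b))
    -- Finite approximability comes from reflecting a realization of the type into `M`.
    (fun b => q.val ⟨φ, b⟩) (fun t δ hδ => by
      obtain ⟨a', ha'⟩ := j.exists_forall_dist_lt hF a
        (fun i => ⟨φ, (t.equivFin.symm i : M.Tuple sy)⟩) hδ
      refine ⟨a', fun b hb => ?_⟩
      obtain ⟨i, hi⟩ := t.equivFin.symm.surjective ⟨b, hb⟩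
      have := (ha' i).le
      rw [hi, ← hq ⟨φ, b⟩] at this
      exact this) (NoAlternation.pos hstab hM) hη (hN M hM)
  refine ⟨c, fun b => ?_⟩
  rw [dEps, medPhi_tp]
  exact hc b

theorem Stable.exists_isDefinition_dPhi (hF : F.Full) (h : Stable.{u, w} T φ) (hM : M.Models T)
    (p : PhiType M φ) :
    ∃ C : ∀ k : ℕ, Fin (2 * stabN.{u, w} T φ (2⁻¹ ^ k) - 1) → M.Tuple sx,
      IsDefinition p (dPhi T φ C) := by
  choose C hC using fun k : ℕ =>
    (h (2⁻¹ ^ k) (by positivity)).exists_dEps_near hF hM p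
  exact ⟨C, continuous_dPhi C, fun b => (flim_eq_of_abs_sub_le fun k => hC k b).symm⟩

end Definability

end ContLogic

theorem mainTheorem4 (L : Signature.{u}) (F : ConnSystem) (hF : F.Full) (T : Theory L F)
    {m n : ℕ} (sx : Fin m → L.Sorts) (sy : Fin n → L.Sorts)
    (φ : Formula L F (Sum.elim sx sy)) :
    (∀ ε : ℝ, 0 < ε → EpsStable.{u, w} T φ ε →
      IsLeast {N : ℕ | NoAlternation.{u, w} T φ ε (N + 1)} (stabN.{u, w} T φ ε) ∧
      ∀ M : MStructure.{u, w} L, M.Models T → ∀ p : PhiType M φ,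
        ∃ c : Fin (2 * stabN.{u, w} T φ ε - 1) → M.Tuple sx, ∀ b : M.Tuple sy,
          |(p.val b : ℝ) - dEps T φ ε c (tp F M b)| ≤ ε) ∧
    (Stable.{u, w} T φ →
      ∀ M : MStructure.{u, w} L, M.Models T → ∀ p : PhiType M φ,
        ∃ C : ∀ k : ℕ, Fin (2 * stabN.{u, w} T φ (2⁻¹ ^ k) - 1) → M.Tuple sx,
          IsDefinition p (dPhi T φ C) ∧
          (∀ ψ : TypeSpace F M sy → unitInterval, IsDefinition p ψ → ψ = dPhi T φ C) ∧
          IsPhiPred φ.swap (dPhi T φ C)) := by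
  refine ⟨fun ε _ h => ⟨h.isLeast_stabN, fun M hM p => h.exists_dEps_near hF hM p⟩,
    fun h M hM p => ?_⟩
  obtain ⟨C, hC⟩ := h.exists_isDefinition_dPhi hF hM p
  exact ⟨C, hC, fun ψ hψ => hψ.1.ext hF hC.1 fun b => (hψ.2 b).symm.trans (hC.2 b),
    isPhiPred_dPhi C⟩
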